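/- A \emph{matroid} $\mathrm{M}$ is given by its lattice of flats $\mathcal{L}_{\mathrm{M}}$: a finite nonempty atomic ranked lattice whose rank function $\operatorname{rk}$ is submodular, i.e. $\operatorname{rk}(F\vee G)+\operatorname{rk}(F\wedge G)\le \operatorname{rk}(F)+\operatorname{rk}(G)$ for all $F,G$. Here atomic means that every element is the join of the atoms below it, and ranked means that all maximal chains in an interval $[\emptyset,F]$ have the same length, which is $\operatorname{rk}(F)$; $\emptyset$ and $E$ denote the minimal and maximal elements, and $\overline{\mathcal{L}}_{\mathrm{M}}=\mathcal{L}_{\mathrm{M}}\setminus\{\emptyset\}$ is the set of nonempty flats. The Chow ring and the augmented Chow ring of $\mathrm{M}$ are $$\underline{A}^{\bullet}(\mathrm{M}) = \frac{\mathbb{Z}[h_F]_{F \in \overline{\mathcal{L}}_{\mathrm{M}}}}{\big((h_{F} - h_{G \vee F})(h_G - h_{G \vee F}) : F, G \in \overline{\mathcal{L}}_{\mathrm{M}}\big) + (h_a : a \text{ atom})},$$ $$A^{\bullet}(\mathrm{M}) = \frac{\mathbb{Z}[h_F]_{F \in \overline{\mathcal{L}}_{\mathrm{M}}}}{\big((h_{F}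 - h_{G \vee F})(h_G - h_{G \vee F}) : F, G \in \overline{\mathcal{L}}_{\mathrm{M}}\big) + \big(h_a^2,\ h_ah_F - h_ah_{F \vee a} : F \in \overline{\mathcal{L}}_{\mathrm{M}},\ a \text{ atom}\big)},$$ graded with every $h_F$ in degree $1$. Their Hilbert series are $$\underline{\mathrm{H}}_{\mathrm{M}}(t)=\sum_{k\ge 0}\operatorname{rank}_{\mathbb{Z}}\big(\underline{A}^k(\mathrm{M})\big)\,t^k \quad\text{and}\quad \mathrm{H}_{\mathrm{M}}(t)=\sum_{k\ge 0}\operatorname{rank}_{\mathbb{Z}}\big(A^k(\mathrm{M})\big)\,t^k.$$ For a flat $F$, let $\mathrm{M}^F$ be the matroid whose lattice of flats is the interval $[\emptyset,F]$. For a matroid $\mathrm{N}$ of positive rank with maximal flat $E$, let the truncation $\operatorname{Tr}\mathrm{N}$ be the matroid whose lattice of flats is obtained from $\mathcal{L}_{\mathrm{N}}$ by removing the flats of rank $\operatorname{rk}(E)-1$. We write $\operatorname{Tr}\mathrm{M}^F$ for $\operatorname{Tr}(\mathrm{M}^F)$. \textbf{Corollary.} For every matroid $\mathrm{M}$, $$\mathrm{H}_{\mathrm{M}}(t)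 = 1 + \sum_{F \in \overline{\mathcal{L}}_{\mathrm{M}}} t \cdot \mathrm{H}_{\operatorname{Tr} \mathrm{M}^F}(t) \quad \text{and} \quad \underline{\mathrm{H}}_{\mathrm{M}}(t) = 1 + \sum_{F \in \mathcal{L}_{\mathrm{M}},\ \operatorname{rk}(F) \ge 2} t \cdot \underline{\mathrm{H}}_{\operatorname{Tr} \mathrm{M}^F}(t).$$ -/

import Mathlib

namespace MatroidChow

noncomputable section

/-- The rank of an element `F` of a finite lattice: the length of a longest chain
`F₀ < F₁ < ⋯ < Fₖ = F`. -/
def rk {L : Type*} [Preorder L] (F : L) : ℕ := (Order.height F).toNat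

/-- A finite lattice is the lattice of flats of a matroid when it is atomic (every element is the
join of the atoms below it), ranked (every maximal chain of an interval `[⊥, F]`, written as a
sequence of covers `⊥ = F₀ ⋖ F₁ ⋖ ⋯ ⋖ Fₖ = F`, has length `rk F`), and its rank function is
submodular. Finiteness is the separate hypothesis `Finite L`, nonemptiness follows from the
presence of `⊥`. -/
class IsMatroidLattice (L : Type*) [Lattice L] [BoundedOrder L] : Prop where
  atomic : ∀ F : L, IsLUB {a : L | IsAtom a ∧ a ≤ F} F
  ranked : ∀ c : RelSeries {p : L × L | p.1 ⋖ p.2}, c.head = ⊥ → c.length = rk c.last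
  submodular : ∀ F G : L, rk (F ⊔ G) + rk (F ⊓ G) ≤ rk F + rk G

/-- The flats other than the minimal one. -/
abbrev NonemptyFlat (L : Type*) [Lattice L] [BoundedOrder L] : Type _ := {F : L // F ≠ ⊥}

/-- The join of two nonempty flats, as a nonempty flat. -/
def NonemptyFlat.join {L : Type*} [Lattice L] [BoundedOrder L] (F G : NonemptyFlat L) :
    NonemptyFlat L :=
  ⟨F.1 ⊔ G.1, fun h => F.2 (sup_eq_bot_iff.mp h).1⟩

section ChowRing

variable (L : Type*) [Lattice L] [BoundedOrder L]

/-- The polynomials `(h_F - h_{G ∨ F}) (h_G - h_{G ∨ F})`, for nonempty flats `F`, `G`. -/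
def joinRelations : Set (MvPolynomial (NonemptyFlat L) ℤ) :=
  {p | ∃ F G : NonemptyFlat L,
    p = (MvPolynomial.X F - MvPolynomial.X (G.join F)) *
      (MvPolynomial.X G - MvPolynomial.X (G.join F))}

/-- The defining ideal of the Chow ring. -/
def chowIdeal : Ideal (MvPolynomial (NonemptyFlat L) ℤ) :=
  Ideal.span (joinRelations L) ⊔
    Ideal.span {p | ∃ a : NonemptyFlat L, IsAtom a.1 ∧ p = MvPolynomial.X a}

/-- The defining ideal of the augmented Chow ring. -/
def augChowIdeal : Ideal (MvPolynomial (NonemptyFlat L) ℤ) :=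
  Ideal.span (joinRelations L) ⊔
    Ideal.span {p | ∃ a F : NonemptyFlat L, IsAtom a.1 ∧
      (p = MvPolynomial.X a ^ 2 ∨
        p = MvPolynomial.X a * MvPolynomial.X F -
          MvPolynomial.X a * MvPolynomial.X (F.join a))}

/-- The Chow ring. -/
abbrev ChowRing : Type _ := MvPolynomial (NonemptyFlat L) ℤ ⧸ chowIdeal L

/-- The augmented Chow ring. -/
abbrev AugChowRing : Type _ := MvPolynomial (NonemptyFlat L) ℤ ⧸ augChowIdeal L

/-- The degree `k` part of a quotient of a polynomial ring over `ℤ`: the classes of the homogeneous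
polynomials of degree `k`, where every variable has degree `1`. -/
def gradedPiece {σ : Type*} (I : Ideal (MvPolynomial σ ℤ)) (k : ℕ) :
    Submodule ℤ (MvPolynomial σ ℤ ⧸ I) :=
  (MvPolynomial.homogeneousSubmodule σ ℤ k).map (Ideal.Quotient.mkₐ ℤ I).toLinearMap

/-- The degree `k` part of the Chow ring. -/
def chowPiece (k : ℕ) : Submodule ℤ (ChowRing L) := gradedPiece (chowIdeal L) k

/-- The degree `k` part of the augmented Chow ring. -/
def augChowPiece (k : ℕ) : Submodule ℤ (AugChowRing L) := gradedPiece (augChowIdeal L) k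

/-- The Hilbert series of the Chow ring: the coefficient of `t ^ k` is the rank of the abelian
group of elements of degree `k`. -/
def hilbertSeries : PowerSeries ℤ :=
  PowerSeries.mk fun k => (Module.finrank ℤ (chowPiece L k) : ℤ)

/-- The Hilbert series of the augmented Chow ring. -/
def augHilbertSeries : PowerSeries ℤ :=
  PowerSeries.mk fun k => (Module.finrank ℤ (augChowPiece L k) : ℤ)

end ChowRing

/-- With finitely many variables the graded pieces are finitely generated abelian groups, so that
`Module.finrank` is their rank. -/
theorem gradedPiece_finite {σ : Type*} [Finite σ] (I : Ideal (MvPolynomial σ ℤ)) (k : ℕ) :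
    Module.Finite ℤ (gradedPiece I k) := by
  exact Module.Finite.iff_fg.mpr ((MvPolynomial.homogeneousSubmodule_fg σ ℤ k).map _)

section Truncation

theorem rk_lt_rk {L : Type*} [Preorder L] [Finite L] {F G : L} (h : F < G) : rk F < rk G := by
  have hfin : ∀ x : L, Order.height x ≠ ⊤ := fun x hx => by
    obtain ⟨p, -, hp⟩ := Order.height_eq_top_iff.mp hx (Nat.card L)
    have := Nat.card_le_card_of_injective p p.strictMono.injective
    simp [hp] at this
  have h1 := Order.height_strictMono h (lt_top_iff_ne_top.mpr (hfin F))
  rw [← ENat.natCast_toNat (hfin F), ← ENat.natCast_toNat (hfin G)] at h1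
  exact_mod_cast h1

theorem eq_top_of_lt {L : Type*} [Lattice L] [BoundedOrder L] [Finite L] {F G : L}
    (hF : rk F + 1 = rk (⊤ : L)) (h : F < G) : G = ⊤ := by
  by_contra hG
  have h1 := rk_lt_rk h
  have h2 := rk_lt_rk (lt_top_iff_ne_top.mpr hG)
  omega

/-- The lattice of flats of the truncation: the flats `F` with `rk F ≠ rk ⊤ - 1`, with the order
inherited from `L`. -/
structure Truncation (L : Type*) [Lattice L] [BoundedOrder L] where
  /-- The underlying flat of `L`. -/
  flat : L
  rk_ne : rk flat + 1 ≠ rk (⊤ : L)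

variable {L : Type*} [Lattice L] [BoundedOrder L]

theorem Truncation.flat_injective : Function.Injective (Truncation.flat (L := L)) := by
  rintro ⟨F, hF⟩ ⟨G, hG⟩ h
  cases h
  rfl

instance : PartialOrder (Truncation L) := PartialOrder.lift _ Truncation.flat_injective

instance [Finite L] : Finite (Truncation L) := Finite.of_injective _ Truncation.flat_injective

open Classical in
/-- The least element of the truncation above a given flat. -/
def Truncation.close (F : L) : Truncation L :=
  if h : rk F + 1 = rk (⊤ : L) then ⟨⊤, by omega⟩ else ⟨F, h⟩

theorem Truncation.gc [Finite L] :
    GaloisConnection (Truncation.close (L := L)) Truncation.flat := by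
  intro F G
  by_cases h : rk F + 1 = rk (⊤ : L)
  · rw [Truncation.close, dif_pos h]
    change ⊤ ≤ G.flat ↔ F ≤ G.flat
    refine ⟨fun hG => le_top.trans hG, fun hG => ?_⟩
    rcases hG.lt_or_eq with hlt | heq
    · exact (eq_top_of_lt h hlt).ge
    · exact absurd (heq ▸ h) G.rk_ne
  · rw [Truncation.close, dif_neg h]
    exact Iff.rfl

/-- Taking the least element of the truncation above a flat is left adjoint to the inclusion. -/
def Truncation.gi [Finite L] :
    GaloisInsertion (Truncation.close (L := L)) Truncation.flat :=
  Truncation.gc.toGaloisInsertion fun G => Truncation.gc.le_u_l G.flat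

/-- The order of the truncation is a lattice order. -/
instance [Finite L] : Lattice (Truncation L) := Truncation.gi.liftLattice

/-- The greatest element of the truncation is that of `L`; its least element is that of `L`, unless
`L` has rank one, where the truncation has just one element. -/
instance [Finite L] : BoundedOrder (Truncation L) := Truncation.gi.liftBoundedOrder

/-- The lattice of flats of `Tr M^F`: the truncation of the interval `[⊥, F]`. -/
abbrev TrRestrict (F : L) : Type _ := Truncation (Set.Iic F)

end Truncation

end

end MatroidChow

namespace MatroidChow

open MvPolynomial

/-! ### Rank, covers and atoms in a matroid lattice -/

section Rank

/-! In positive degree each ring splits into shifted copies of rings of truncations: multiplication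
by the classes `h_E` gives an isomorphism from the direct sum of the `A^k(Tr M^E)` onto
`A^{k+1}(M)`, and likewise for the Chow ring with `rk E ≥ 2`. Comparing ranks in each degree gives
both series.

The maps exist because `h_E h_K = h_E ^ 2` for a hyperplane `K` of `E`
(`IsFlatMap.mul_eq_mul_self`): after multiplication by `h_E`, hyperplanes are identified with `E`,
as in the truncation. Together they are onto because `h_F h_G = h_{F ∨ G} (h_F + h_G - h_{F ∨ G})`,
so a product of classes can be rewritten as a combination of products `h_E` times classes of flats
below `E` (`IsFlatMap.span_range_pow_le`).

Injectivity comes from an explicit left inverse `divTop`. The polynomial ring is graded by the join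
of the flats in a monomial. Take the component of join `E`, substitute `h_G ↦ u_G + ω` with `ω ^ 2 =
-u_E ω`, where `u_G` is the class of `G` in the ring of `Tr M^E`, and read off the coefficient of
`ω`. As `ω (u_E + ω) = 0`, this sends `h_E q` to `q`, and it sends `h_F q'` to `0` if `F ≠ E` and
`q'` involves only flats below `F`. It kills the defining ideal because `ω` acts on `h_G` as `u_G -
u_E`, and such products vanish as soon as their flats join to `E` or to a hyperplane of `E`
(`dvd_sub_mul_evalFlat_monomial`).

Both rings satisfy the relations of `IsFlatMap`, so one argument, `finrank_piece_succ`, serves both.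
-/

theorem rk_bot {L : Type*} [PartialOrder L] [OrderBot L] : rk (⊥ : L) = 0 := by
  simp [rk]

theorem rk_eq_zero {L : Type*} [PartialOrder L] [OrderBot L] [Finite L] {F : L} :
    rk F = 0 ↔ F = ⊥ := by
  refine ⟨fun h => ?_, fun h => h ▸ rk_bot⟩
  by_contra hF
  have := rk_lt_rk (bot_lt_iff_ne_bot.mpr hF)
  omega

theorem rk_coe_Iic {L : Type*} [PartialOrder L] {E : L} (F : Set.Iic E) : rk F = rk (F : L) := by
  unfold rk
  rw [Order.height_eq_of_strictMono (fun x : Set.Iic E => (x : L)) (fun _ _ h => h)]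
  exact fun G H h => ⟨⟨H, h.le.trans G.2⟩, h, rfl⟩

theorem rk_eq_one_of_isAtom {L : Type*} [PartialOrder L] [OrderBot L] [Finite L] {a : L}
    (ha : IsAtom a) : rk a = 1 := by
  have h1 : Order.height a ≤ (1 : ℕ) := Order.height_le_coe_iff.mpr fun y hy => by
    simp [ha.2 y hy]
  have h2 := rk_lt_rk ha.bot_lt
  have h3 : rk a ≤ 1 := ENat.toNat_le_of_le_natCast h1
  omega

theorem isAtom_iff_rk_eq_one {L : Type*} [PartialOrder L] [OrderBot L] [Finite L] {a : L} :
    IsAtom a ↔ rk a = 1 := by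
  refine ⟨rk_eq_one_of_isAtom, fun h => ⟨fun h' => ?_, fun b hb => ?_⟩⟩
  · simp [h', rk_bot] at h
  · have := rk_lt_rk hb
    exact rk_eq_zero.mp (by omega)

/-- By atomicity some atom below `E` is not below `K`, and the cover leaves only `E` for its join
with `K`. -/
theorem exists_isAtom_sup_eq {L : Type*} [Lattice L] [BoundedOrder L] [IsMatroidLattice L]
    {K E : L} (h : K ⋖ E) : ∃ a : L, IsAtom a ∧ a ≤ E ∧ K ⊔ a = E := by
  by_contra! hc
  refine h.lt.not_ge ((IsMatroidLattice.atomic E).2 fun a ha => ?_)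
  have h1 : K ⊔ a ≤ E := sup_le h.le ha.2
  rcases h.eq_or_eq le_sup_left h1 with h2 | h2
  · exact le_sup_right.trans h2.le
  · exact absurd h2 (hc a ha.1 ha.2)

variable {L : Type*} [Lattice L] [BoundedOrder L] [Finite L] [IsMatroidLattice L]

theorem rk_sup_le_of_isAtom {a : L} (ha : IsAtom a) (F : L) : rk (F ⊔ a) ≤ rk F + 1 := by
  have h := IsMatroidLattice.submodular F a
  rw [isAtom_iff_rk_eq_one.mp ha] at h
  omega

/-- Submodularity bounds the rank gained by adjoining an atom by one. So the flats removed by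
truncation are exactly those covered by the top. -/
theorem rk_add_one_eq_iff {K E : L} (h : K ≤ E) : rk K + 1 = rk E ↔ K ⋖ E := by
  refine ⟨fun hr => ⟨lt_of_le_of_ne h (by rintro rfl; omega), fun M h1 h2 => ?_⟩, fun hc => ?_⟩
  · have := rk_lt_rk h1
    have := rk_lt_rk h2
    omega
  · obtain ⟨a, ha, -, rfl⟩ := exists_isAtom_sup_eq hc
    have := rk_sup_le_of_isAtom ha K
    have := rk_lt_rk hc.lt
    omega

theorem wcovBy_sup_of_isAtom {a : L} (ha : IsAtom a) (F : L) : F ⩿ F ⊔ a := by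
  refine ⟨le_sup_left, fun M h1 h2 => ?_⟩
  have := rk_lt_rk h1
  have := rk_lt_rk h2
  have := rk_sup_le_of_isAtom ha F
  omega

end Rank

noncomputable section

/-! ### The truncation of an interval, seen inside the lattice -/

namespace TrRestrict

variable {L : Type*} [Lattice L] [BoundedOrder L] {E : L}

/-- The flat of `L` underlying a flat of the truncation of `[⊥, E]`. -/
def toFlat (y : TrRestrict E) : L := (y.flat : L)

/-- The least flat of the truncation of `[⊥, E]` above `G ⊓ E`. -/
def ofFlat (E G : L) : TrRestrict E := Truncation.close ⟨G ⊓ E, inf_le_right⟩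

theorem toFlat_le (y : TrRestrict E) : y.toFlat ≤ E := y.flat.2

theorem toFlat_le_toFlat {x y : TrRestrict E} : x.toFlat ≤ y.toFlat ↔ x ≤ y := Iff.rfl

theorem toFlat_injective : Function.Injective (toFlat : TrRestrict E → L) :=
  fun _ _ h => Truncation.flat_injective (Subtype.ext h)

theorem rk_toFlat_add_one_ne (y : TrRestrict E) : rk y.toFlat + 1 ≠ rk E := by
  have h := y.rk_ne
  rwa [rk_coe_Iic, rk_coe_Iic] at h

theorem toFlat_ofFlat_of_rk_ne {G : L} (hG : G ≤ E) (h : rk G + 1 ≠ rk E) :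
    (ofFlat E G).toFlat = G := by
  unfold ofFlat toFlat Truncation.close
  rw [dif_neg]
  · simpa using hG
  · rw [rk_coe_Iic, rk_coe_Iic]
    simpa [inf_eq_left.mpr hG] using h

theorem toFlat_ofFlat_of_rk_eq {G : L} (hG : G ≤ E) (h : rk G + 1 = rk E) :
    (ofFlat E G).toFlat = E := by
  unfold ofFlat toFlat Truncation.close
  rw [dif_pos]
  · rfl
  · rw [rk_coe_Iic, rk_coe_Iic]
    simpa [inf_eq_left.mpr hG] using h

theorem ofFlat_toFlat (y : TrRestrict E) : ofFlat E y.toFlat = y :=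
  toFlat_injective (toFlat_ofFlat_of_rk_ne y.toFlat_le y.rk_toFlat_add_one_ne)

variable [Finite L]

theorem ofFlat_le_iff {G : L} (hG : G ≤ E) {y : TrRestrict E} : ofFlat E G ≤ y ↔ G ≤ y.toFlat := by
  refine (Truncation.gc _ y).trans ?_
  change G ⊓ E ≤ y.toFlat ↔ _
  rw [inf_eq_left.mpr hG]

theorem ofFlat_sup {G H : L} (hG : G ≤ E) (hH : H ≤ E) :
    ofFlat E (G ⊔ H) = ofFlat E G ⊔ ofFlat E H :=
  eq_of_forall_ge_iff fun y => by
    rw [ofFlat_le_iff (sup_le hG hH), sup_le_iff, sup_le_iff, ofFlat_le_iff hG, ofFlat_le_iff hH]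

theorem ofFlat_bot : ofFlat E ⊥ = ⊥ :=
  le_bot_iff.mp ((ofFlat_le_iff bot_le).mpr bot_le)

theorem eq_bot_of_toFlat_eq_bot {y : TrRestrict E} (h : y.toFlat = ⊥) : y = ⊥ := by
  rw [← y.ofFlat_toFlat, h, ofFlat_bot]

variable [IsMatroidLattice L]

/-- This is the one feature of the truncation needed to kill the atom relations: hyperplanes of `E`
become `E`. -/
theorem ofFlat_eq_of_wcovBy {K : L} (h : K ⩿ E) : ofFlat E K = ofFlat E E := by
  rcases h.covBy_or_eq with h | rfl
  · apply toFlat_injective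
    rw [toFlat_ofFlat_of_rk_eq h.le ((rk_add_one_eq_iff h.le).mpr h),
      toFlat_ofFlat_of_rk_ne le_rfl (by omega)]
  · rfl

theorem toFlat_ofFlat {G : L} (hG : G ≤ E) :
    (ofFlat E G).toFlat = G ∨ G ⋖ E ∧ (ofFlat E G).toFlat = E := by
  by_cases h : rk G + 1 = rk E
  · exact .inr ⟨(rk_add_one_eq_iff hG).mp h, toFlat_ofFlat_of_rk_eq hG h⟩
  · exact .inl (toFlat_ofFlat_of_rk_ne hG h)

theorem ofFlat_eq_bot_or_isAtom {a : L} (ha : IsAtom a) (haE : a ≤ E) :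
    ofFlat E a = ⊥ ∨ IsAtom (ofFlat E a) := by
  refine or_iff_not_imp_left.mpr fun h => ⟨h, fun y hy => eq_bot_of_toFlat_eq_bot ?_⟩
  have hlt : y.toFlat < (ofFlat E a).toFlat :=
    lt_of_le_not_ge (toFlat_le_toFlat.mpr hy.le) fun h' => hy.not_ge (toFlat_le_toFlat.mp h')
  rcases toFlat_ofFlat haE with h' | ⟨h1, h'⟩
  · exact ha.2 _ (h' ▸ hlt)
  · rw [h'] at hlt
    have h2 := rk_lt_rk hlt
    have h3 := y.rk_toFlat_add_one_ne
    have h4 := (rk_add_one_eq_iff haE).mpr h1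
    have h5 := isAtom_iff_rk_eq_one.mp ha
    exact rk_eq_zero.mp (by omega)

theorem exists_isAtom_ofFlat_eq {y : TrRestrict E} (hy : IsAtom y) :
    ∃ a : L, IsAtom a ∧ a ≤ E ∧ ofFlat E a = y := by
  have : y.toFlat ≠ ⊥ := fun h => hy.1 (eq_bot_of_toFlat_eq_bot h)
  obtain ⟨a, ha, hay⟩ := (eq_bot_or_exists_atom_le y.toFlat).resolve_left this
  have haE := hay.trans y.toFlat_le
  refine ⟨a, ha, haE, (hy.le_iff.mp ((ofFlat_le_iff haE).mpr hay)).resolve_left fun h => ?_⟩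
  have h1 : a ≤ (⊥ : TrRestrict E).toFlat := (ofFlat_le_iff haE).mp h.le
  -- The least flat of the truncation is `⊥`, except in rank one, where it is `E`.
  have h2 : (⊥ : TrRestrict E).toFlat = ⊥ ∨ (⊥ : L) ⋖ E ∧ (⊥ : TrRestrict E).toFlat = E := by
    simpa [ofFlat_bot] using toFlat_ofFlat (E := E) bot_le
  rcases h2 with h2 | ⟨-, h2⟩
  · exact ha.1 (le_bot_iff.mp (h1.trans h2.le))
  · exact hy.1 (le_bot_iff.mp (toFlat_le_toFlat.mp (y.toFlat_le.trans h2.ge)))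

end TrRestrict

/-- Maps `h` from the flats to a commutative ring that satisfy, below `E`, the relations which the
classes `h_F` satisfy in both Chow rings, with the convention `h_⊥ = 0`. -/
structure IsFlatMap {L R : Type*} [Lattice L] [BoundedOrder L] [CommRing R] (E : L) (h : L → R) :
    Prop where
  map_bot : h ⊥ = 0
  sub_mul_sub : ∀ F G : L, F ≤ E → G ≤ E → (h F - h (F ⊔ G)) * (h G - h (F ⊔ G)) = 0
  atom_mul : ∀ a F : L, IsAtom a → a ≤ E → F ≤ E → h a * h F = h a * h (F ⊔ a)

/-! ### Quotient rings and the classes of flats -/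

section QuotRing

/-- The quotient of a polynomial ring by an ideal, as a ring whose only `ℤ`-module structure is the
one of its additive group. -/
def QuotRing {σ : Type*} (I : Ideal (MvPolynomial σ ℤ)) : Type _ := MvPolynomial σ ℤ ⧸ I

variable {σ : Type*} {I : Ideal (MvPolynomial σ ℤ)}

instance : CommRing (QuotRing I) := inferInstanceAs (CommRing (MvPolynomial σ ℤ ⧸ I))

/-- The quotient map. -/
def QuotRing.mk (I : Ideal (MvPolynomial σ ℤ)) : MvPolynomial σ ℤ →+* QuotRing I :=
  Ideal.Quotient.mk I

theorem QuotRing.mk_eq_zero_iff {p : MvPolynomial σ ℤ} : QuotRing.mk I p = 0 ↔ p ∈ I :=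
  Ideal.Quotient.eq_zero_iff_mem

theorem QuotRing.mk_surjective : Function.Surjective (QuotRing.mk I) :=
  Ideal.Quotient.mk_surjective

/-- The classes of the homogeneous polynomials of degree `k`. -/
def QuotRing.piece (I : Ideal (MvPolynomial σ ℤ)) (k : ℕ) : Submodule ℤ (QuotRing I) :=
  (homogeneousSubmodule σ ℤ k).map (QuotRing.mk I).toIntAlgHom.toLinearMap

theorem finrank_gradedPiece (I : Ideal (MvPolynomial σ ℤ)) (k : ℕ) :
    Module.finrank ℤ (gradedPiece I k) = Module.finrank ℤ (QuotRing.piece I k) :=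
  rfl

instance [Finite σ] (k : ℕ) : Module.Finite ℤ (QuotRing.piece I k) :=
  Module.Finite.iff_fg.mpr ((homogeneousSubmodule_fg σ ℤ k).map _)

end QuotRing

section FlatClass

variable {L : Type*} [Lattice L] [BoundedOrder L]

open Classical in
/-- The class of the variable of a flat in a quotient of the polynomial ring, `0` for `⊥`. -/
def flatClass (I : Ideal (MvPolynomial (NonemptyFlat L) ℤ)) (F : L) :
    QuotRing I :=
  if hF : F = ⊥ then 0 else QuotRing.mk I (X ⟨F, hF⟩)

theorem flatClass_bot (I : Ideal (MvPolynomial (NonemptyFlat L) ℤ)) : flatClass I ⊥ = 0 :=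
  dif_pos rfl

theorem flatClass_of_ne_bot (I : Ideal (MvPolynomial (NonemptyFlat L) ℤ)) {F : L} (hF : F ≠ ⊥) :
    flatClass I F = QuotRing.mk I (X ⟨F, hF⟩) :=
  dif_neg hF

theorem mk_X_eq_flatClass (I : Ideal (MvPolynomial (NonemptyFlat L) ℤ)) (F : NonemptyFlat L) :
    QuotRing.mk I (X F) = flatClass I F.1 :=
  (flatClass_of_ne_bot I F.2).symm

theorem flatClass_sub_mul_sub {I : Ideal (MvPolynomial (NonemptyFlat L) ℤ)}
    (hI : joinRelations L ⊆ I) (F G : L) :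
    (flatClass I F - flatClass I (F ⊔ G)) * (flatClass I G - flatClass I (F ⊔ G)) = 0 := by
  rcases eq_or_ne F ⊥ with rfl | hF
  · simp
  rcases eq_or_ne G ⊥ with rfl | hG
  · simp
  have h := QuotRing.mk_eq_zero_iff.mpr (hI ⟨⟨F, hF⟩, ⟨G, hG⟩, rfl⟩)
  simpa only [map_mul, map_sub, mk_X_eq_flatClass, NonemptyFlat.join, sup_comm G F] using h

/-- With `h_⊥ = 0`, the relation `h_a ^ 2 = 0` is the case `F = ⊥` of `atom_mul`. -/
theorem isFlatMap_flatClass_augChowIdeal : IsFlatMap (⊤ : L) (flatClass (augChowIdeal L)) where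
  map_bot := flatClass_bot _
  sub_mul_sub F G _ _ :=
    flatClass_sub_mul_sub (fun _ hp => Ideal.mem_sup_left (Ideal.subset_span hp)) F G
  atom_mul a F ha _ _ := by
    have hmem : (X ⟨a, ha.1⟩ ^ 2 : MvPolynomial (NonemptyFlat L) ℤ) ∈ augChowIdeal L :=
      Ideal.mem_sup_right (Ideal.subset_span ⟨⟨a, ha.1⟩, ⟨a, ha.1⟩, ha, .inl rfl⟩)
    have hsq := QuotRing.mk_eq_zero_iff.mpr hmem
    rw [map_pow, mk_X_eq_flatClass, pow_two] at hsq
    rcases eq_or_ne F ⊥ with rfl | hF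
    · rw [flatClass_bot, bot_sup_eq, mul_zero, hsq]
    · have hmem : (X ⟨a, ha.1⟩ * X ⟨F, hF⟩ -
          X ⟨a, ha.1⟩ * X (NonemptyFlat.join ⟨F, hF⟩ ⟨a, ha.1⟩) :
            MvPolynomial (NonemptyFlat L) ℤ) ∈ augChowIdeal L :=
        Ideal.mem_sup_right (Ideal.subset_span ⟨⟨a, ha.1⟩, ⟨F, hF⟩, ha, .inr rfl⟩)
      have h := QuotRing.mk_eq_zero_iff.mpr hmem
      simpa only [map_mul, map_sub, mk_X_eq_flatClass, NonemptyFlat.join, sub_eq_zero] using h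

theorem flatClass_chowIdeal_of_isAtom {a : L} (ha : IsAtom a) : flatClass (chowIdeal L) a = 0 := by
  rw [flatClass_of_ne_bot _ ha.1]
  exact QuotRing.mk_eq_zero_iff.mpr (Ideal.mem_sup_right (Ideal.subset_span
    ⟨⟨a, ha.1⟩, ha, rfl⟩))

theorem isFlatMap_flatClass_chowIdeal : IsFlatMap (⊤ : L) (flatClass (chowIdeal L)) where
  map_bot := flatClass_bot _
  sub_mul_sub F G _ _ :=
    flatClass_sub_mul_sub (fun _ hp => Ideal.mem_sup_left (Ideal.subset_span hp)) F G
  atom_mul a F ha _ _ := by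
    rw [flatClass_chowIdeal_of_isAtom ha, zero_mul, zero_mul]

/-- Closing up in the truncation preserves joins and sends an atom to an atom or to `⊥`, so the
relations pull back. -/
theorem IsFlatMap.comp_ofFlat [Finite L] [IsMatroidLattice L] {E : L} {R : Type*} [CommRing R]
    {h : TrRestrict E → R} (hh : IsFlatMap ⊤ h) : IsFlatMap E fun G => h (TrRestrict.ofFlat E G) where
  map_bot := by rw [TrRestrict.ofFlat_bot, hh.map_bot]
  sub_mul_sub F G hF hG := by
    rw [TrRestrict.ofFlat_sup hF hG]
    exact hh.sub_mul_sub _ _ le_top le_top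
  atom_mul a F ha haE hF := by
    rw [TrRestrict.ofFlat_sup hF haE]
    rcases TrRestrict.ofFlat_eq_bot_or_isAtom ha haE with h' | h'
    · rw [h', hh.map_bot, zero_mul, zero_mul]
    · exact hh.atom_mul _ _ h' le_top le_top

end FlatClass

/-! ### The grading by joins and formal division by `h_E` -/

section JoinDegree

/-- A join semilattice as a commutative monoid under join, used to weight variables. -/
def JoinMonoid (L : Type*) : Type _ := L

/-- An element of the semilattice as an element of the monoid. -/
def JoinMonoid.of {L : Type*} (F : L) : JoinMonoid L := F

/-- With joins as sums, weighted homogeneity grades the polynomial ring by the lattice. The weight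
of a positive power of `h_F` is again `F`. -/
instance {L : Type*} [Lattice L] [BoundedOrder L] : AddCommMonoid (JoinMonoid L) where
  add F G := (F ⊔ G : L)
  zero := (⊥ : L)
  add_assoc F G H := sup_assoc (α := L) F G H
  zero_add F := bot_sup_eq (α := L) F
  add_zero F := sup_bot_eq (α := L) F
  add_comm F G := sup_comm (α := L) F G
  nsmul := @nsmulRec _ ⟨(⊥ : L)⟩ ⟨fun F G => (F ⊔ G : L)⟩
  nsmul_zero _ := rfl
  nsmul_succ _ _ := rfl

variable {L : Type*} [Lattice L] [BoundedOrder L]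

/-- The weight of a variable is its flat. -/
def joinWeight (F : NonemptyFlat L) : JoinMonoid L := .of F.1

/-- The polynomials all of whose monomials have join `F`. -/
def IsJoinHomogeneous (p : MvPolynomial (NonemptyFlat L) ℤ) (F : L) : Prop :=
  IsWeightedHomogeneous joinWeight p (JoinMonoid.of F)

theorem IsJoinHomogeneous.mul {p q : MvPolynomial (NonemptyFlat L) ℤ} {F G : L}
    (hp : IsJoinHomogeneous p F) (hq : IsJoinHomogeneous q G) :
    IsJoinHomogeneous (p * q) (F ⊔ G) :=
  IsWeightedHomogeneous.mul hp hq

theorem IsJoinHomogeneous.sub {p q : MvPolynomial (NonemptyFlat L) ℤ} {F : L}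
    (hp : IsJoinHomogeneous p F) (hq : IsJoinHomogeneous q F) : IsJoinHomogeneous (p - q) F :=
  IsWeightedHomogeneous.sub hp hq

theorem isJoinHomogeneous_X (F : NonemptyFlat L) : IsJoinHomogeneous (X F) F.1 :=
  isWeightedHomogeneous_X _ _ _

variable {R : Type*} [CommRing R] (u : L → R) (E : L)

/-- The ring homomorphism `h_G ↦ u_G + ω`, where `ω ^ 2 = - u_E ω`. -/
def shiftHom : MvPolynomial (NonemptyFlat L) ℤ →+* QuadraticAlgebra R 0 (-u E) :=
  eval₂Hom (Int.castRingHom _) fun G => ⟨u G.1, 1⟩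

theorem shiftHom_X (G : NonemptyFlat L) : shiftHom u E (X G) = ⟨u G.1, 1⟩ :=
  eval₂Hom_X' _ _ _

/-- Take the part of a polynomial with join `E` and divide it formally by `h_E`: the coefficient of
`ω` after the substitution `h_G ↦ u_G + ω`. -/
def divTop : MvPolynomial (NonemptyFlat L) ℤ →+ R where
  toFun p := (shiftHom u E (weightedHomogeneousComponent joinWeight (JoinMonoid.of E) p)).im
  map_zero' := by simp
  map_add' p q := by simp

variable {u E}

open Classical in
theorem divTop_of_isJoinHomogeneous {p : MvPolynomial (NonemptyFlat L) ℤ} {F : L}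
    (hp : IsJoinHomogeneous p F) : divTop u E p = if E = F then (shiftHom u E p).im else 0 := by
  change (shiftHom u E (weightedHomogeneousComponent joinWeight (JoinMonoid.of E) p)).im = _
  rw [weightedHomogeneousComponent_of_mem hp]
  change (shiftHom u E (if E = F then p else 0)).im = _
  split_ifs <;> simp

/-- The join of the flats in a monomial. -/
def monomialJoin (m : NonemptyFlat L →₀ ℕ) : L := Finsupp.weight (M := JoinMonoid L) joinWeight m

theorem monomialJoin_zero : monomialJoin (0 : NonemptyFlat L →₀ ℕ) = ⊥ :=
  map_zero (Finsupp.weight (M := JoinMonoid L) joinWeight)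

theorem monomialJoin_add (m n : NonemptyFlat L →₀ ℕ) :
    monomialJoin (m + n) = monomialJoin m ⊔ monomialJoin n :=
  map_add (Finsupp.weight (M := JoinMonoid L) joinWeight) m n

theorem monomialJoin_single (F : NonemptyFlat L) : monomialJoin (Finsupp.single F 1) = F.1 :=
  (Finsupp.weight_single (M := JoinMonoid L) joinWeight F 1).trans (one_nsmul (M := JoinMonoid L) _)

theorem isJoinHomogeneous_monomial (m : NonemptyFlat L →₀ ℕ) (c : ℤ) :
    IsJoinHomogeneous (monomial m c) (monomialJoin m) :=
  isWeightedHomogeneous_monomial _ _ _ rfl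

/-- Since `divTop` is only additive, it must be tested on all monomial multiples of the generators.
-/
theorem addMonoidHom_eq_zero_of_mem_span {σ A : Type*} [AddCommGroup A]
    (f : MvPolynomial σ ℤ →+ A) (S : Set (MvPolynomial σ ℤ))
    (hf : ∀ r ∈ S, ∀ m, f (monomial m 1 * r) = 0) {p : MvPolynomial σ ℤ} (hp : p ∈ Ideal.span S) :
    f p = 0 := by
  have key : ∀ q, f (q * p) = 0 := by
    refine Submodule.span_induction (fun r hr q => ?_) (by simp) (fun x y _ _ hx hy q => ?_)
      (fun a x _ hx q => ?_) hp
    · induction q using MvPolynomial.induction_on' with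
      | monomial m c =>
        have : monomial m c = c • monomial m (1 : ℤ) := by simp [smul_monomial]
        rw [this, smul_mul_assoc, map_zsmul, hf r hr m, smul_zero]
      | add p q hp hq => rw [add_mul, map_add, hp, hq, add_zero]
    · rw [mul_add, map_add, hx, hy, add_zero]
    · rw [smul_eq_mul, ← mul_assoc]
      exact hx _
  simpa using key 1

/-- All four monomials of the relation have join `F ∨ G`, so the relation is homogeneous. In its
differences `ω` cancels, which leaves the same relation among the `u_G`. -/
theorem divTop_mul_joinRelation (hu : IsFlatMap E u) (q : MvPolynomial (NonemptyFlat L) ℤ) {J : L}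
    (hq : IsJoinHomogeneous q J) {r : MvPolynomial (NonemptyFlat L) ℤ} (hr : r ∈ joinRelations L) :
    divTop u E (q * r) = 0 := by
  obtain ⟨F, G, rfl⟩ := hr
  have hF : IsJoinHomogeneous (X F * X G : MvPolynomial (NonemptyFlat L) ℤ) (G.join F).1 := by
    have := (isJoinHomogeneous_X F).mul (isJoinHomogeneous_X G)
    rwa [sup_comm] at this
  have h1 := (isJoinHomogeneous_X F).mul (isJoinHomogeneous_X (G.join F))
  have h2 := (isJoinHomogeneous_X G).mul (isJoinHomogeneous_X (G.join F))
  have h3 := (isJoinHomogeneous_X (G.join F)).mul (isJoinHomogeneous_X (G.join F))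
  rw [sup_eq_right.mpr (show F.1 ≤ (G.join F).1 from le_sup_right)] at h1
  rw [sup_eq_right.mpr (show G.1 ≤ (G.join F).1 from le_sup_left)] at h2
  rw [sup_idem] at h3
  have h : IsJoinHomogeneous ((X F - X (G.join F)) * (X G - X (G.join F)) :
      MvPolynomial (NonemptyFlat L) ℤ) (G.join F).1 := by
    have := (hF.sub h1).sub (h2.sub h3)
    convert this using 1
    ring
  rw [divTop_of_isJoinHomogeneous (hq.mul h)]
  split_ifs with hE
  · have hle : (G.join F).1 ≤ E := hE ▸ le_sup_right
    have hrel := hu.sub_mul_sub F.1 G.1 (le_sup_right.trans hle) (le_sup_left.trans hle)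
    have : shiftHom u E ((X F - X (G.join F)) * (X G - X (G.join F))) = 0 := by
      simp only [map_mul, map_sub, shiftHom_X, NonemptyFlat.join, sup_comm G.1 F.1]
      ext
      · simpa using hrel
      · simp
    rw [map_mul, this, mul_zero, QuadraticAlgebra.im_zero]
  · rfl

end JoinDegree

/-! ### Formal division kills the atom relations -/

section DivTop

variable {L : Type*} [Lattice L] [BoundedOrder L] {R : Type*} [CommRing R] {u : L → R} {E : L}

/-- The ring homomorphism `h_G ↦ u_G`. -/
def evalFlat (u : L → R) : MvPolynomial (NonemptyFlat L) ℤ →+* R :=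
  eval₂Hom (Int.castRingHom R) fun G => u G.1

theorem evalFlat_X (G : NonemptyFlat L) : evalFlat u (X G) = u G.1 :=
  eval₂Hom_X' _ _ _

/-- From `ω (u_G + ω) = (u_G - u_E) ω`. -/
theorem omega_mul_shiftHom (p : MvPolynomial (NonemptyFlat L) ℤ) :
    (⟨0, 1⟩ * shiftHom u E p : QuadraticAlgebra R 0 (-u E)) =
      ⟨0, evalFlat (fun G => u G - u E) p⟩ := by
  induction p using MvPolynomial.induction_on with
  | C c => ext <;> simp [shiftHom, evalFlat]
  | add p q hp hq => rw [map_add, map_add, mul_add, hp, hq]; ext <;> simp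
  | mul_X p G hp =>
    rw [map_mul, map_mul, ← mul_assoc, hp, shiftHom_X, evalFlat_X]
    ext <;> simp
    ring

/-- From `(u_E + ω) ω = 0`: next to the image of `h_E`, every other `ω` disappears. -/
theorem top_mul_shiftHom (p : MvPolynomial (NonemptyFlat L) ℤ) :
    (⟨u E, 1⟩ * shiftHom u E p : QuadraticAlgebra R 0 (-u E)) =
      ⟨u E * evalFlat u p, evalFlat u p⟩ := by
  induction p using MvPolynomial.induction_on with
  | C c => ext <;> simp [shiftHom, evalFlat]
  | add p q hp hq => rw [map_add, map_add, mul_add, hp, hq]; ext <;> (simp; try ring)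
  | mul_X p G hp =>
    rw [map_mul, map_mul, ← mul_assoc, hp, shiftHom_X, evalFlat_X]
    ext <;> (simp; try ring)

/-- By the join relation, `(u_G - u_E) (u_F - u_E)` is a multiple of `u_{G ∨ F} - u_E`. Absorbing
the factors of `m` one at a time collects them into one factor for the total join. -/
theorem dvd_sub_mul_evalFlat_monomial (hu : IsFlatMap E u) (m : NonemptyFlat L →₀ ℕ) {G : L}
    (hG : G ≤ E) (hm : monomialJoin m ≤ E) :
    u (G ⊔ monomialJoin m) - u E ∣
      (u G - u E) * evalFlat (fun G => u G - u E) (monomial m 1) := by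
  have hadd : ∀ m n : NonemptyFlat L →₀ ℕ,
      (∀ G ≤ E, monomialJoin m ≤ E → u (G ⊔ monomialJoin m) - u E ∣
        (u G - u E) * evalFlat (fun G => u G - u E) (monomial m 1)) →
      (∀ G ≤ E, monomialJoin n ≤ E → u (G ⊔ monomialJoin n) - u E ∣
        (u G - u E) * evalFlat (fun G => u G - u E) (monomial n 1)) →
      ∀ G ≤ E, monomialJoin (m + n) ≤ E → u (G ⊔ monomialJoin (m + n)) - u E ∣
        (u G - u E) * evalFlat (fun G => u G - u E) (monomial (m + n) 1) := by
    intro m n hm hn G hG hmn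
    rw [monomialJoin_add] at hmn ⊢
    have h1 := hm G hG (le_sup_left.trans hmn)
    have h2 := hn (G ⊔ monomialJoin m) (sup_le hG (le_sup_left.trans hmn)) (le_sup_right.trans hmn)
    rw [sup_assoc] at h2
    refine h2.trans ((mul_dvd_mul_right h1 _).trans (dvd_of_eq ?_))
    rw [mul_assoc, ← map_mul, monomial_mul, mul_one]
  have hzero : ∀ G ≤ E, monomialJoin (0 : NonemptyFlat L →₀ ℕ) ≤ E →
      u (G ⊔ monomialJoin (0 : NonemptyFlat L →₀ ℕ)) - u E ∣
        (u G - u E) * evalFlat (fun G => u G - u E) (monomial 0 1) := by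
    intro G _ _
    rw [monomialJoin_zero, sup_bot_eq]
    exact dvd_mul_right _ _
  revert hm hG G
  induction m using Finsupp.induction_linear with
  | zero => exact fun {G} => hzero G
  | add m n hm hn => exact fun {G} => hadd m n (fun G => @hm G) (fun G => @hn G) G
  | single F n =>
    intro G
    revert G
    induction n with
    | zero => rw [Finsupp.single_zero]; exact fun {G} => hzero G
    | succ n ih =>
      rw [Finsupp.single_add]
      refine fun {G} => hadd _ _ (fun G => @ih G) (fun G hG hF => ?_) G
      rw [monomialJoin_single] at hF ⊢
      -- The cofactor is read off from `u_G u_F = u_{G ∨ F} (u_G + u_F - u_{G ∨ F})`.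
      refine ⟨u G + u F.1 - u (G ⊔ F.1) - u E, ?_⟩
      have h := hu.sub_mul_sub G F.1 hG hF
      rw [show (monomial (Finsupp.single F 1) 1 : MvPolynomial (NonemptyFlat L) ℤ) = X F from rfl,
        evalFlat_X]
      linear_combination h

theorem sub_mul_evalFlat_monomial_eq_zero (hu : IsFlatMap E u) (m : NonemptyFlat L →₀ ℕ) {G : L}
    (hG : G ≤ E) (hm : monomialJoin m ≤ E) (h : u (G ⊔ monomialJoin m) = u E) :
    (u G - u E) * evalFlat (fun G => u G - u E) (monomial m 1) = 0 := by
  have := dvd_sub_mul_evalFlat_monomial hu m hG hm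
  rwa [h, sub_self, zero_dvd_iff] at this

theorem evalFlat_monomial_eq_zero (hu : IsFlatMap E u) {m : NonemptyFlat L →₀ ℕ} (hm0 : m ≠ 0)
    (hm : monomialJoin m ≤ E) (h : u (monomialJoin m) = u E) :
    evalFlat (fun G => u G - u E) (monomial m 1) = 0 := by
  obtain ⟨F, hF⟩ := Finsupp.support_nonempty_iff.mpr hm0
  obtain ⟨n, rfl⟩ : ∃ n, m = Finsupp.single F 1 + n := by
    refine ⟨m - Finsupp.single F 1, (add_tsub_cancel_of_le ?_).symm⟩
    rw [Finsupp.single_le_iff]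
    exact Nat.one_le_iff_ne_zero.mpr (Finsupp.mem_support_iff.mp hF)
  rw [monomialJoin_add, monomialJoin_single] at hm h
  have h1 := sub_mul_evalFlat_monomial_eq_zero hu n (le_sup_left.trans hm)
    (le_sup_right.trans hm) h
  rw [← one_mul (1 : ℤ), ← monomial_mul, map_mul]
  rwa [show (monomial (Finsupp.single F 1) 1 : MvPolynomial (NonemptyFlat L) ℤ) = X F from rfl,
    evalFlat_X]

variable [Finite L] [IsMatroidLattice L]

/-- By `atom_mul` the relation becomes `ω (u_F - u_{F ∨ a})`. Writing the difference as `(u_F - u_E)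
- (u_{F ∨ a} - u_E)` makes each term, times the image of `m`, a product that vanishes. -/
theorem divTop_mul_atomRelation (hu : IsFlatMap E u) (hcov : ∀ K, K ⩿ E → u K = u E)
    (m : NonemptyFlat L →₀ ℕ) {a : NonemptyFlat L} (ha : IsAtom a.1) (F : NonemptyFlat L) :
    divTop u E (monomial m 1 * (X a * X F - X a * X (F.join a))) = 0 := by
  have h1 := (isJoinHomogeneous_X a).mul (isJoinHomogeneous_X F)
  have h2 := (isJoinHomogeneous_X a).mul (isJoinHomogeneous_X (F.join a))
  rw [sup_eq_right.mpr (show a.1 ≤ (F.join a).1 from le_sup_right)] at h2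
  rw [sup_comm] at h1
  rw [divTop_of_isJoinHomogeneous ((isJoinHomogeneous_monomial m 1).mul (h1.sub h2))]
  split_ifs with hE
  · have hFa : (F.join a).1 ≤ E := hE ▸ le_sup_right
    have hm : monomialJoin m ≤ E := hE ▸ le_sup_left
    have hF : F.1 ≤ E := le_sup_left.trans hFa
    have haE : a.1 ≤ E := le_sup_right.trans hFa
    have hmul := hu.atom_mul a.1 F.1 ha haE hF
    have hr : shiftHom u E (X a * X F - X a * X (F.join a)) =
        ⟨0, 1⟩ * ⟨u F.1 - u (F.join a).1, 0⟩ := by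
      simp only [map_mul, map_sub, shiftHom_X, NonemptyFlat.join]
      ext
      · simpa [sub_eq_zero] using hmul
      · simp
    -- Adjoining `a` to this join gives `E`, so it is `E` or a hyperplane of `E`.
    have e1 : u (F.1 ⊔ monomialJoin m) = u E := hcov _ <| by
      have h : F.1 ⊔ monomialJoin m ⊔ a.1 = E :=
        (sup_right_comm _ _ _).trans ((sup_comm _ _).trans hE.symm)
      exact h ▸ wcovBy_sup_of_isAtom ha (F.1 ⊔ monomialJoin m)
    have e2 : u ((F.join a).1 ⊔ monomialJoin m) = u E :=
      congrArg u ((sup_comm _ _).trans hE.symm)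
    have z1 := sub_mul_evalFlat_monomial_eq_zero hu m hF hm e1
    have z2 := sub_mul_evalFlat_monomial_eq_zero hu m hFa hm e2
    rw [map_mul, hr, ← mul_assoc, mul_comm (shiftHom u E _), omega_mul_shiftHom]
    simp only [QuadraticAlgebra.im_mul]
    linear_combination z1 - z2
  · rfl

theorem divTop_mul_atom_sq (hu : IsFlatMap E u) (hcov : ∀ K, K ⩿ E → u K = u E)
    (m : NonemptyFlat L →₀ ℕ) {a : NonemptyFlat L} (ha : IsAtom a.1) :
    divTop u E (monomial m 1 * X a ^ 2) = 0 := by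
  have h1 := (isJoinHomogeneous_X a).mul (isJoinHomogeneous_X a)
  rw [sup_idem, ← pow_two] at h1
  rw [divTop_of_isJoinHomogeneous ((isJoinHomogeneous_monomial m 1).mul h1)]
  split_ifs with hE
  · have haE : a.1 ≤ E := hE ▸ le_sup_right
    have hm : monomialJoin m ≤ E := hE ▸ le_sup_left
    have hsq : u a.1 * u a.1 = 0 := by
      have := hu.atom_mul a.1 ⊥ ha haE bot_le
      rwa [hu.map_bot, mul_zero, bot_sup_eq, eq_comm] at this
    -- Here `(u_a + ω) ^ 2 = u_a ^ 2 + (2 u_a - u_E) ω`, and `u_a ^ 2 = 0`.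
    have hr : shiftHom u E (X a ^ 2) = ⟨0, 1⟩ * ⟨2 * u a.1 - u E, 0⟩ := by
      rw [pow_two, map_mul, shiftHom_X]
      ext
      · simpa using hsq
      · simp
        ring
    have hw : monomialJoin m ⩿ E := hE ▸ wcovBy_sup_of_isAtom ha (monomialJoin m)
    rw [map_mul, hr, ← mul_assoc, mul_comm (shiftHom u E _), omega_mul_shiftHom]
    simp only [QuadraticAlgebra.im_mul]
    rcases eq_or_ne m 0 with rfl | hm0
    -- For `m = 0` the flat `E` is the atom `a` itself, which covers `⊥`, so `u_a = u_E = u_⊥ = 0`.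
    · rw [monomialJoin_zero] at hw
      rw [monomialJoin_zero, bot_sup_eq] at hE
      have h0 := hcov _ hw
      rw [hu.map_bot] at h0
      rw [← hE, ← h0]
      simp
    · rw [evalFlat_monomial_eq_zero hu hm0 hm (hcov _ hw)]
      simp
  · rfl

/-- Since `u_a = 0`, the variable becomes `ω`. As `E` is not an atom, `m` is not constant, and its
join is `E` or a hyperplane of `E`. -/
theorem divTop_mul_atom (hu : IsFlatMap E u) (hcov : ∀ K, K ⩿ E → u K = u E)
    (m : NonemptyFlat L →₀ ℕ) {a : NonemptyFlat L} (ha : IsAtom a.1) (hua : a.1 ≤ E → u a.1 = 0)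
    (hE' : ¬IsAtom E) :
    divTop u E (monomial m 1 * X a) = 0 := by
  rw [divTop_of_isJoinHomogeneous ((isJoinHomogeneous_monomial m 1).mul (isJoinHomogeneous_X a))]
  split_ifs with hE
  · have haE : a.1 ≤ E := hE ▸ le_sup_right
    have hm : monomialJoin m ≤ E := hE ▸ le_sup_left
    have hw : monomialJoin m ⩿ E := hE ▸ wcovBy_sup_of_isAtom ha (monomialJoin m)
    have hm0 : m ≠ 0 := by
      rintro rfl
      rw [monomialJoin_zero, bot_sup_eq] at hE
      exact hE' (hE ▸ ha)
    rw [map_mul, shiftHom_X, hua haE, mul_comm, omega_mul_shiftHom,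
      evalFlat_monomial_eq_zero hu hm0 hm (hcov _ hw)]
  · rfl

end DivTop

/-! ### Formal division inverts multiplication by `h_E` -/

section LeftInverse

variable {L : Type*} [Lattice L] [BoundedOrder L] {R : Type*} [CommRing R] {u : L → R}

theorem isJoinHomogeneous_X_mul_rename {Y : Type*} (E : NonemptyFlat L) (f : Y → NonemptyFlat L)
    (hf : ∀ y, (f y).1 ≤ E.1) (q : MvPolynomial Y ℤ) : IsJoinHomogeneous (X E * rename f q) E.1 := by
  induction q using MvPolynomial.induction_on with
  | C c =>
    rw [rename_C, mul_comm]
    exact IsWeightedHomogeneous.C_mul (isJoinHomogeneous_X E) c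
  | add p q hp hq =>
    rw [map_add, mul_add]
    exact IsWeightedHomogeneous.add hp hq
  | mul_X p y hp =>
    rw [map_mul, rename_X, ← mul_assoc]
    have := hp.mul (isJoinHomogeneous_X (f y))
    rwa [sup_eq_left.mpr (hf y)] at this

theorem divTop_X_mul_rename {Y : Type*} (E : NonemptyFlat L) (f : Y → NonemptyFlat L)
    (hf : ∀ y, (f y).1 ≤ E.1) (q : MvPolynomial Y ℤ) :
    divTop u E.1 (X E * rename f q) = evalFlat u (rename f q) := by
  rw [divTop_of_isJoinHomogeneous (isJoinHomogeneous_X_mul_rename E f hf q), if_pos rfl, map_mul,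
    shiftHom_X, top_mul_shiftHom]

theorem divTop_X_mul_rename_of_ne {Y : Type*} {E : L} (F : NonemptyFlat L) (hEF : E ≠ F.1)
    (f : Y → NonemptyFlat L) (hf : ∀ y, (f y).1 ≤ F.1) (q : MvPolynomial Y ℤ) :
    divTop u E (X F * rename f q) = 0 := by
  rw [divTop_of_isJoinHomogeneous (isJoinHomogeneous_X_mul_rename F f hf q), if_neg hEF]

end LeftInverse

/-! ### Multiplication by `h_E` factors through the truncation -/

section TopMul

variable {L : Type*} [Lattice L] [BoundedOrder L] {A : Type*} [CommRing A] {h : L → A}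

/-- Write `E = K ∨ a`. The join relation for `K` and `a` expands to `h_K h_a - h_E h_K - h_E h_a +
h_E ^ 2 = 0`, and `h_a h_K = h_a h_E`. -/
theorem IsFlatMap.mul_eq_mul_self [IsMatroidLattice L] (hh : IsFlatMap ⊤ h) {K E : L}
    (hK : K ⋖ E) : h E * h K = h E * h E := by
  obtain ⟨a, ha, -, rfl⟩ := exists_isAtom_sup_eq hK
  linear_combination hh.atom_mul a K ha le_top le_top - hh.sub_mul_sub K a le_top le_top

theorem IsFlatMap.mul_toFlat_ofFlat [Finite L] [IsMatroidLattice L] (hh : IsFlatMap ⊤ h) {E G : L}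
    (hG : G ≤ E) : h E * h (TrRestrict.ofFlat E G).toFlat = h E * h G := by
  rcases TrRestrict.toFlat_ofFlat hG with h' | ⟨hc, h'⟩
  · rw [h']
  · rw [h', hh.mul_eq_mul_self hc]

end TopMul

section Multiplication

variable {L : Type*} [Lattice L] [BoundedOrder L] [Finite L]

/-- The nonempty flat of `L` underlying a nonempty flat of the truncation of `[⊥, E]`. -/
def TrRestrict.toNonemptyFlat {E : L} (y : NonemptyFlat (TrRestrict E)) : NonemptyFlat L :=
  ⟨y.1.toFlat, fun h => y.2 (TrRestrict.eq_bot_of_toFlat_eq_bot h)⟩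

variable (I : Ideal (MvPolynomial (NonemptyFlat L) ℤ)) (E : L)

/-- The ring homomorphism which sends the variable of a flat of the truncation of `[⊥, E]` to the
class of the same flat of `L`. -/
def truncationHom : MvPolynomial (NonemptyFlat (TrRestrict E)) ℤ →ₐ[ℤ]
    QuotRing I :=
  (QuotRing.mk I).toIntAlgHom.comp (rename TrRestrict.toNonemptyFlat)

variable {I E}

theorem truncationHom_X (y : NonemptyFlat (TrRestrict E)) :
    truncationHom I E (X y) = flatClass I y.1.toFlat := by
  change QuotRing.mk I (rename TrRestrict.toNonemptyFlat (X y)) = _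
  rw [rename_X]
  exact mk_X_eq_flatClass I (TrRestrict.toNonemptyFlat y)

/-- The polynomials killed after multiplication by `h_E` form an ideal, so generators suffice. -/
theorem mul_truncationHom_eq_zero {S : Set (MvPolynomial (NonemptyFlat (TrRestrict E)) ℤ)}
    (hS : ∀ r ∈ S, flatClass I E * truncationHom I E r = 0)
    {q : MvPolynomial (NonemptyFlat (TrRestrict E)) ℤ} (hq : q ∈ Ideal.span S) :
    flatClass I E * truncationHom I E q = 0 := by
  refine Submodule.span_induction hS (by simp) (fun x y _ _ hx hy => ?_) (fun a x _ hx => ?_) hq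
  · rw [map_add, mul_add, hx, hy, add_zero]
  · rw [smul_eq_mul, map_mul, mul_left_comm, hx, mul_zero]

variable [IsMatroidLattice L]

theorem mul_truncationHom_joinRelation (hh : IsFlatMap ⊤ (flatClass I))
    {r : MvPolynomial (NonemptyFlat (TrRestrict E)) ℤ} (hr : r ∈ joinRelations (TrRestrict E)) :
    flatClass I E * truncationHom I E r = 0 := by
  obtain ⟨y, z, rfl⟩ := hr
  have hw : z.1 ⊔ y.1 = TrRestrict.ofFlat E (z.1.toFlat ⊔ y.1.toFlat) := by
    rw [TrRestrict.ofFlat_sup z.1.toFlat_le y.1.toFlat_le, TrRestrict.ofFlat_toFlat,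
      TrRestrict.ofFlat_toFlat]
  have h1 := hh.mul_toFlat_ofFlat (sup_le z.1.toFlat_le y.1.toFlat_le)
  rw [← hw] at h1
  have h2 := hh.sub_mul_sub z.1.toFlat y.1.toFlat le_top le_top
  simp only [map_mul, map_sub, truncationHom_X, NonemptyFlat.join]
  generalize flatClass I (z.1 ⊔ y.1).toFlat = w at *
  generalize flatClass I (z.1.toFlat ⊔ y.1.toFlat) = w' at *
  -- The joins `w` in the truncation and `w'` in `L` may differ, but `h_E w = h_E w'`.
  linear_combination flatClass I E * h2 +
    (w + w' - flatClass I y.1.toFlat - flatClass I z.1.toFlat) * h1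

theorem mul_truncationHom_atom (hh : IsFlatMap ⊤ (flatClass I))
    {y : NonemptyFlat (TrRestrict E)} (hy : IsAtom y.1) :
    ∃ a : L, IsAtom a ∧ a ≤ E ∧ TrRestrict.ofFlat E a = y.1 ∧
      flatClass I E * flatClass I y.1.toFlat = flatClass I E * flatClass I a := by
  obtain ⟨a, ha, haE, h⟩ := TrRestrict.exists_isAtom_ofFlat_eq hy
  exact ⟨a, ha, haE, h, h ▸ hh.mul_toFlat_ofFlat haE⟩

theorem mul_truncationHom_atomRelation (hh : IsFlatMap ⊤ (flatClass I))
    {y : NonemptyFlat (TrRestrict E)} (hy : IsAtom y.1) (z : NonemptyFlat (TrRestrict E)) :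
    flatClass I E * truncationHom I E (X y * X z - X y * X (z.join y)) = 0 := by
  obtain ⟨a, ha, haE, h, h1⟩ := mul_truncationHom_atom hh hy
  have hw : z.1 ⊔ y.1 = TrRestrict.ofFlat E (z.1.toFlat ⊔ a) := by
    rw [TrRestrict.ofFlat_sup z.1.toFlat_le haE, TrRestrict.ofFlat_toFlat, h]
  have h2 := hh.mul_toFlat_ofFlat (sup_le z.1.toFlat_le haE)
  rw [← hw] at h2
  have h3 := hh.atom_mul a z.1.toFlat ha le_top le_top
  simp only [map_mul, map_sub, truncationHom_X, NonemptyFlat.join]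
  generalize flatClass I (z.1 ⊔ y.1).toFlat = w at *
  linear_combination flatClass I E * h3 + (flatClass I z.1.toFlat - w) * h1 - flatClass I a * h2

theorem mul_truncationHom_atom_sq (hh : IsFlatMap ⊤ (flatClass I))
    {y : NonemptyFlat (TrRestrict E)} (hy : IsAtom y.1) :
    flatClass I E * truncationHom I E (X y ^ 2) = 0 := by
  obtain ⟨a, ha, haE, h, h1⟩ := mul_truncationHom_atom hh hy
  have h3 := hh.atom_mul a ⊥ ha le_top le_top
  rw [hh.map_bot, mul_zero, bot_sup_eq] at h3
  simp only [map_pow, truncationHom_X]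
  linear_combination (flatClass I y.1.toFlat + flatClass I a) * h1 - flatClass I E * h3

end Multiplication

/-! ### The products with the classes `h_E` span the positive degrees -/

section Generation

variable {L : Type*} [Lattice L] [BoundedOrder L] {A : Type*} [CommRing A] {h : L → A}

/-- Multiplying `h_F` times flats below `F` by a further `h_G` replaces the leading flat by `F ∨ G`,
and everything else still lies below it. -/
theorem IsFlatMap.span_range_pow_le (hh : IsFlatMap ⊤ h) (k : ℕ) :
    Submodule.span ℤ (Set.range h) ^ (k + 1) ≤
      ⨆ E : L, Submodule.span ℤ {h E} * Submodule.span ℤ (h '' Set.Iic E) ^ k := by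
  induction k with
  | zero => simp [Submodule.span_range_eq_iSup]
  | succ k ih =>
    rw [pow_succ]
    refine (mul_le_mul' ih le_rfl).trans ?_
    rw [Submodule.iSup_mul, Submodule.span_range_eq_iSup]
    refine iSup_le fun F => ?_
    rw [Submodule.mul_iSup]
    refine iSup_le fun G => le_iSup_of_le (F ⊔ G) ?_
    have hmem : ∀ {H : L}, H ≤ F ⊔ G → h H ∈ Submodule.span ℤ (h '' Set.Iic (F ⊔ G)) :=
      fun hH => Submodule.subset_span ⟨_, hH, rfl⟩
    have h1 : Submodule.span ℤ {h F} * Submodule.span ℤ {h G} ≤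
        Submodule.span ℤ {h (F ⊔ G)} * Submodule.span ℤ (h '' Set.Iic (F ⊔ G)) := by
      rw [Submodule.span_mul_span, Set.singleton_mul_singleton, Submodule.span_singleton_le_iff_mem]
      have : h F * h G = h (F ⊔ G) * (h F + h G - h (F ⊔ G)) := by
        linear_combination hh.sub_mul_sub F G le_top le_top
      rw [this]
      exact Submodule.mul_mem_mul (Submodule.mem_span_singleton_self _)
        (sub_mem (add_mem (hmem le_sup_left) (hmem le_sup_right)) (hmem le_rfl))
    have h2 : Submodule.span ℤ (h '' Set.Iic F) ≤ Submodule.span ℤ (h '' Set.Iic (F ⊔ G)) :=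
      Submodule.span_mono (Set.image_mono (Set.Iic_subset_Iic.mpr le_sup_left))
    calc _ = Submodule.span ℤ {h F} * Submodule.span ℤ {h G} *
          Submodule.span ℤ (h '' Set.Iic F) ^ k := by ring
      _ ≤ Submodule.span ℤ {h (F ⊔ G)} * Submodule.span ℤ (h '' Set.Iic (F ⊔ G)) *
          Submodule.span ℤ (h '' Set.Iic (F ⊔ G)) ^ k :=
        mul_le_mul' h1 (pow_le_pow_left' h2 k)
      _ = _ := by ring

variable [Finite L] [IsMatroidLattice L]

theorem IsFlatMap.span_mul_pow_le (hh : IsFlatMap ⊤ h) (E : L) (k : ℕ) :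
    Submodule.span ℤ {h E} * Submodule.span ℤ (h '' Set.Iic E) ^ k ≤
      Submodule.span ℤ {h E} *
        Submodule.span ℤ (Set.range fun y : NonemptyFlat (TrRestrict E) => h y.1.toFlat) ^ k := by
  induction k with
  | zero => simp
  | succ k ih =>
    rw [pow_succ, ← mul_assoc, pow_succ, ← mul_assoc]
    refine (mul_le_mul' ih le_rfl).trans ?_
    rw [mul_right_comm, mul_right_comm _ (_ ^ k)]
    refine mul_le_mul' ?_ le_rfl
    rw [Submodule.span_mul_span, Submodule.span_le]
    rintro _ ⟨_, rfl, _, ⟨G, hG, rfl⟩, rfl⟩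
    change h E * h G ∈ _
    by_cases h0 : TrRestrict.ofFlat E G = ⊥
    -- If `G` becomes least in the truncation, it has no variable there, but then `h_E h_G = h_E h_⊥
    -- = 0`.
    · have : h E * h G = 0 := by
        rw [← hh.mul_toFlat_ofFlat hG, h0, ← TrRestrict.ofFlat_bot, hh.mul_toFlat_ofFlat bot_le,
          hh.map_bot, mul_zero]
      rw [this]
      exact zero_mem _
    · rw [← hh.mul_toFlat_ofFlat hG]
      exact Submodule.mul_mem_mul (Submodule.mem_span_singleton_self _)
        (Submodule.subset_span ⟨⟨_, h0⟩, rfl⟩)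

end Generation

/-- The graded pieces are not known to be free at this point, so ranks are compared over the
fraction field. -/
theorem finrank_pi_of_isDomain {R ι : Type*} [CommRing R] [IsDomain R] [Fintype ι] {M : ι → Type*}
    [∀ i, AddCommGroup (M i)] [∀ i, Module R (M i)] [∀ i, Module.Finite R (M i)] :
    Module.finrank R (∀ i, M i) = ∑ i, Module.finrank R (M i) := by
  let S := nonZeroDivisors R
  let N (i : ι) := LocalizedModule S (M i)
  have h1 : Module.finrank R (∀ i, N i) = Module.finrank R (∀ i, M i) :=
    IsLocalizedModule.finrank_eq S (LinearMap.pi fun i =>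
      LocalizedModule.mkLinearMap S (M i) ∘ₗ LinearMap.proj i) le_rfl
  have h2 (i : ι) : Module.finrank R (N i) = Module.finrank R (M i) :=
    IsLocalizedModule.finrank_eq S (LocalizedModule.mkLinearMap S (M i)) le_rfl
  have (i : ι) : Module.Finite (FractionRing R) (N i) :=
    Module.Finite.of_isLocalizedModule S (LocalizedModule.mkLinearMap S (M i))
  rw [← h1, ← IsFractionRing.finrank_right_eq R (FractionRing R), Module.finrank_pi_fintype]
  refine Finset.sum_congr rfl fun i _ => ?_
  rw [← h2, ← IsFractionRing.finrank_right_eq R (FractionRing R)]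

/-! ### Ranks of the graded pieces -/

section Piece

variable {L : Type*} [Lattice L] [BoundedOrder L]

theorem QuotRing.piece_eq_pow {σ : Type*} (I : Ideal (MvPolynomial σ ℤ)) (k : ℕ) :
    QuotRing.piece I k =
      Submodule.span ℤ (Set.range fun i => QuotRing.mk I (X i)) ^ k := by
  rw [QuotRing.piece, ← homogeneousSubmodule_one_pow, Submodule.map_pow,
    homogeneousSubmodule_one_eq_span_X, Submodule.map_span, ← Set.range_comp]
  rfl

/-- The ideal contains no nonzero constant, so the constants embed as the degree zero part. -/
theorem finrank_piece_zero {σ : Type*} (I : Ideal (MvPolynomial σ ℤ))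
    (hI : ∀ p ∈ I, constantCoeff p = 0) : Module.finrank ℤ (QuotRing.piece I 0) = 1 := by
  rw [QuotRing.piece_eq_pow, pow_zero, Submodule.one_eq_span]
  have h1 : LinearMap.ker (LinearMap.toSpanSingleton ℤ _ (1 : QuotRing I)) = ⊥ := by
    rw [LinearMap.ker_eq_bot']
    intro n hn
    have : QuotRing.mk I (C n) = 0 := by
      rw [LinearMap.toSpanSingleton_apply, zsmul_one] at hn
      rw [← hn]
      simp
    simpa using hI _ (QuotRing.mk_eq_zero_iff.mp this)
  rw [← LinearMap.range_toSpanSingleton,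
    LinearMap.finrank_range_of_inj (LinearMap.ker_eq_bot.mp h1), Module.finrank_self]

theorem constantCoeff_eq_zero_of_mem_span {σ : Type*} {S : Set (MvPolynomial σ ℤ)}
    (hS : ∀ r ∈ S, constantCoeff r = 0) {p : MvPolynomial σ ℤ} (hp : p ∈ Ideal.span S) :
    constantCoeff p = 0 :=
  (Ideal.span_le (I := RingHom.ker (constantCoeff (R := ℤ) (σ := σ)))).mpr hS hp

variable [Finite L] {I : Ideal (MvPolynomial (NonemptyFlat L) ℤ)} {E : L}

/-- Multiplication by the class of `E`, from a quotient of the polynomial ring of the truncation of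
`[⊥, E]`. -/
def mulTop (J : Ideal (MvPolynomial (NonemptyFlat (TrRestrict E)) ℤ))
    (hJ : ∀ q ∈ J, flatClass I E * truncationHom I E q = 0) :
    QuotRing J →ₗ[ℤ] QuotRing I :=
  -- Semilinearity over the polynomial ring lets the map descend to the quotient by `J`, viewed as a
  -- submodule.
  let f : MvPolynomial (NonemptyFlat (TrRestrict E)) ℤ →ₛₗ[(truncationHom I E).toRingHom]
      QuotRing I :=
    { toFun := fun q => flatClass I E * truncationHom I E q
      map_add' := fun p q => by rw [map_add, mul_add]
      map_smul' := fun p q => by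
        rw [smul_eq_mul, map_mul, mul_left_comm]
        rfl }
  AddMonoidHom.toIntLinearMap
    { toFun := fun x : QuotRing J => J.liftQ f hJ x
      map_zero' := map_zero (J.liftQ f hJ)
      map_add' := map_add (J.liftQ f hJ) }

theorem mulTop_mk (J : Ideal (MvPolynomial (NonemptyFlat (TrRestrict E)) ℤ))
    (hJ : ∀ q ∈ J, flatClass I E * truncationHom I E q = 0)
    (q : MvPolynomial (NonemptyFlat (TrRestrict E)) ℤ) :
    mulTop J hJ (QuotRing.mk J q) = flatClass I E * truncationHom I E q :=
  rfl

theorem map_mulTop_piece (J : Ideal (MvPolynomial (NonemptyFlat (TrRestrict E)) ℤ))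
    (hJ : ∀ q ∈ J, flatClass I E * truncationHom I E q = 0) (k : ℕ) :
    (QuotRing.piece J k).map (mulTop J hJ) = Submodule.span ℤ {flatClass I E} * Submodule.span ℤ
      (Set.range fun y : NonemptyFlat (TrRestrict E) => flatClass I y.1.toFlat) ^ k := by
  have h1 : Submodule.span ℤ
      (Set.range fun y : NonemptyFlat (TrRestrict E) => flatClass I y.1.toFlat) ^ k =
      (homogeneousSubmodule _ ℤ k).map (truncationHom I E).toLinearMap := by
    rw [← homogeneousSubmodule_one_pow, Submodule.map_pow, homogeneousSubmodule_one_eq_span_X,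
      Submodule.map_span, ← Set.range_comp]
    congr 3
    funext y
    exact (truncationHom_X y).symm
  ext x
  rw [h1, Submodule.mem_span_singleton_mul]
  constructor
  · rintro ⟨_, ⟨q, hq, rfl⟩, rfl⟩
    exact ⟨_, ⟨q, hq, rfl⟩, rfl⟩
  · rintro ⟨_, ⟨q, hq, rfl⟩, rfl⟩
    exact ⟨_, ⟨q, hq, rfl⟩, rfl⟩

theorem evalFlat_rename_toNonemptyFlat
    (J : Ideal (MvPolynomial (NonemptyFlat (TrRestrict E)) ℤ))
    (q : MvPolynomial (NonemptyFlat (TrRestrict E)) ℤ) :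
    evalFlat (fun G => flatClass J (TrRestrict.ofFlat E G))
      (rename TrRestrict.toNonemptyFlat q) = QuotRing.mk J q := by
  induction q using MvPolynomial.induction_on with
  | C c => simp [evalFlat]
  | add p q hp hq => rw [map_add, map_add, map_add, hp, hq]
  | mul_X p y hp =>
    rw [map_mul, map_mul, map_mul, hp, rename_X, evalFlat_X, mk_X_eq_flatClass]
    congr 2
    exact TrRestrict.ofFlat_toFlat y.1

variable [IsMatroidLattice L]

/-- `S` indexes the summands: outside it `h_E = 0`, so nothing is lost in generation. The hypothesis
`hJ` makes multiplication by `h_E` well defined, and `hdiv` does the same for its left inverse. -/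
theorem finrank_piece_succ (hI : IsFlatMap ⊤ (flatClass I)) (S : Finset L)
    (hS : ∀ E ∈ S, E ≠ ⊥) (hS' : ∀ E ∉ S, flatClass I E = 0)
    (J : ∀ E : L, Ideal (MvPolynomial (NonemptyFlat (TrRestrict E)) ℤ))
    (hJ : ∀ E, ∀ q ∈ J E, flatClass I E * truncationHom I E q = 0)
    (hdiv : ∀ E ∈ S, ∀ p ∈ I,
      divTop (fun G => flatClass (J E) (TrRestrict.ofFlat E G)) E p = 0) (k : ℕ) :
    Module.finrank ℤ (QuotRing.piece I (k + 1)) =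
      ∑ E ∈ S, Module.finrank ℤ (QuotRing.piece (J E) k) := by
  classical
  let Φ : (∀ E : S, QuotRing.piece (J E) k) →ₗ[ℤ] QuotRing I :=
    LinearMap.lsum ℤ _ ℤ fun E => mulTop (J E) (hJ E) ∘ₗ (QuotRing.piece (J E) k).subtype
  have hΦ : ∀ x, Φ x = ∑ E : S, mulTop (J E) (hJ E) (x E).1 := fun x => by
    simp [Φ]
  have hinj : Function.Injective Φ := by
    rw [← LinearMap.ker_eq_bot, LinearMap.ker_eq_bot']
    intro x hx
    choose q hq using fun E : S => QuotRing.mk_surjective (x E).1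
    -- A relation among the summands lifts to a polynomial in `I`. Dividing it formally by `h_F`
    -- isolates the component at `F`.
    have hmem : ∑ E : S, X ⟨E.1, hS E.1 E.2⟩ * rename TrRestrict.toNonemptyFlat (q E) ∈ I := by
      rw [← QuotRing.mk_eq_zero_iff, ← hx, hΦ, map_sum]
      refine Finset.sum_congr rfl fun E _ => ?_
      rw [← hq, mulTop_mk, map_mul, mk_X_eq_flatClass]
      rfl
    funext F
    have h := hdiv F.1 F.2 _ hmem
    rw [map_sum, Finset.sum_eq_single F] at h
    · rw [divTop_X_mul_rename ⟨F.1, hS F.1 F.2⟩ _ fun y => y.1.toFlat_le,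
        evalFlat_rename_toNonemptyFlat, hq] at h
      exact Subtype.ext h
    · intro E _ hE
      exact divTop_X_mul_rename_of_ne ⟨E.1, hS E.1 E.2⟩ (fun h' => hE (Subtype.ext h'.symm)) _
        (fun y => y.1.toFlat_le) _
    · simp
  have hrange : LinearMap.range Φ = QuotRing.piece I (k + 1) := by
    have hle : Submodule.span ℤ (Set.range fun i => QuotRing.mk I (X i)) ≤
        Submodule.span ℤ (Set.range (flatClass I)) :=
      Submodule.span_mono (by rintro _ ⟨i, rfl⟩; exact ⟨i.1, (mk_X_eq_flatClass I i).symm⟩)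
    have hge : Submodule.span ℤ (Set.range (flatClass I)) ≤
        Submodule.span ℤ (Set.range fun i => QuotRing.mk I (X i)) := by
      rw [Submodule.span_le]
      rintro _ ⟨F, rfl⟩
      by_cases hF : F = ⊥
      · rw [hF, flatClass_bot]
        exact zero_mem _
      · rw [flatClass_of_ne_bot I hF]
        exact Submodule.subset_span ⟨_, rfl⟩
    rw [QuotRing.piece_eq_pow, le_antisymm hle hge]
    apply le_antisymm
    · rintro _ ⟨x, rfl⟩
      rw [hΦ]
      refine Submodule.sum_mem _ fun E _ => ?_
      have h1 : mulTop (J E) (hJ E) (x E).1 ∈ (QuotRing.piece (J E) k).map (mulTop (J E) (hJ E)) :=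
        ⟨_, (x E).2, rfl⟩
      rw [map_mulTop_piece] at h1
      rw [pow_succ']
      refine mul_le_mul' (Submodule.span_mono ?_) (pow_le_pow_left'
        (Submodule.span_mono ?_) k) h1
      · rintro _ rfl
        exact ⟨_, rfl⟩
      · rintro _ ⟨y, rfl⟩
        exact ⟨_, rfl⟩
    · refine (hI.span_range_pow_le k).trans (iSup_le fun E => (hI.span_mul_pow_le E k).trans ?_)
      by_cases hE : E ∈ S
      · rw [← map_mulTop_piece (J E) (hJ E)]
        rintro _ ⟨x, hx, rfl⟩
        refine ⟨Pi.single ⟨E, hE⟩ ⟨x, hx⟩, ?_⟩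
        rw [hΦ, Finset.sum_eq_single ⟨E, hE⟩]
        · simp
        · intro F _ hF
          rw [Pi.single_eq_of_ne hF]
          exact map_zero _
        · simp
      · rw [hS' E hE, Submodule.span_zero_singleton, Submodule.bot_mul]
        exact bot_le
  rw [← hrange, LinearMap.finrank_range_of_inj hinj, finrank_pi_of_isDomain,
    Finset.sum_coe_sort S fun E => Module.finrank ℤ (QuotRing.piece (J E) k)]

end Piece

end

/-! ### The two recursions -/

section Main

variable {L : Type*} [Lattice L] [BoundedOrder L]

theorem augChowIdeal_eq_span : augChowIdeal L = Ideal.span (joinRelations L ∪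
    {p | ∃ a F : NonemptyFlat L, IsAtom a.1 ∧
      (p = X a ^ 2 ∨ p = X a * X F - X a * X (F.join a))}) :=
  (Ideal.span_union _ _).symm

theorem chowIdeal_eq_span : chowIdeal L = Ideal.span (joinRelations L ∪
    {p | ∃ a : NonemptyFlat L, IsAtom a.1 ∧ p = X a}) :=
  (Ideal.span_union _ _).symm

theorem constantCoeff_joinRelation {p : MvPolynomial (NonemptyFlat L) ℤ}
    (hp : p ∈ joinRelations L) : constantCoeff p = 0 := by
  obtain ⟨F, G, rfl⟩ := hp
  simp

theorem finrank_augChowPiece_zero : Module.finrank ℤ (augChowPiece L 0) = 1 := by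
  refine (finrank_gradedPiece _ 0).trans (finrank_piece_zero _ fun p hp => ?_)
  rw [augChowIdeal_eq_span] at hp
  refine constantCoeff_eq_zero_of_mem_span ?_ hp
  rintro r (hr | ⟨a, F, -, rfl | rfl⟩)
  · exact constantCoeff_joinRelation hr
  · simp
  · simp

theorem finrank_chowPiece_zero : Module.finrank ℤ (chowPiece L 0) = 1 := by
  refine (finrank_gradedPiece _ 0).trans (finrank_piece_zero _ fun p hp => ?_)
  rw [chowIdeal_eq_span] at hp
  refine constantCoeff_eq_zero_of_mem_span ?_ hp
  rintro r (hr | ⟨a, -, rfl⟩)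
  · exact constantCoeff_joinRelation hr
  · simp

variable [Fintype L] [IsMatroidLattice L]

theorem finrank_augChowPiece_succ [DecidableEq L] (k : ℕ) :
    Module.finrank ℤ (augChowPiece L (k + 1)) =
      ∑ F : L with F ≠ ⊥, Module.finrank ℤ (augChowPiece (TrRestrict F) k) := by
  have hI := isFlatMap_flatClass_augChowIdeal (L := L)
  refine finrank_piece_succ hI _ (fun E hE => (Finset.mem_filter.mp hE).2) (fun E hE => ?_)
    (fun E => augChowIdeal (TrRestrict E)) (fun E q hq => ?_) (fun E _ p hp => ?_) k
  · rw [show E = ⊥ by simpa using hE, flatClass_bot]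
  · rw [augChowIdeal_eq_span] at hq
    refine mul_truncationHom_eq_zero ?_ hq
    rintro r (hr | ⟨a, F, ha, rfl | rfl⟩)
    · exact mul_truncationHom_joinRelation hI hr
    · exact mul_truncationHom_atom_sq hI ha
    · exact mul_truncationHom_atomRelation hI ha F
  · have hu := (isFlatMap_flatClass_augChowIdeal (L := TrRestrict E)).comp_ofFlat
    have hcov : ∀ K, K ⩿ E → flatClass (augChowIdeal (TrRestrict E)) (TrRestrict.ofFlat E K) =
        flatClass (augChowIdeal (TrRestrict E)) (TrRestrict.ofFlat E E) :=
      fun K hK => congrArg _ (TrRestrict.ofFlat_eq_of_wcovBy hK)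
    rw [augChowIdeal_eq_span] at hp
    refine addMonoidHom_eq_zero_of_mem_span _ _ ?_ hp
    rintro r (hr | ⟨a, F, ha, rfl | rfl⟩) m
    · exact divTop_mul_joinRelation hu _ (isJoinHomogeneous_monomial m 1) hr
    · exact divTop_mul_atom_sq hu hcov m ha
    · exact divTop_mul_atomRelation hu hcov m ha F

theorem finrank_chowPiece_succ (k : ℕ) :
    Module.finrank ℤ (chowPiece L (k + 1)) =
      ∑ F : L with 2 ≤ rk F, Module.finrank ℤ (chowPiece (TrRestrict F) k) := by
  have hI := isFlatMap_flatClass_chowIdeal (L := L)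
  refine finrank_piece_succ hI _ (fun E hE => ?_) (fun E hE => ?_)
    (fun E => chowIdeal (TrRestrict E)) (fun E q hq => ?_) (fun E hE p hp => ?_) k
  · rintro rfl
    have := (Finset.mem_filter.mp hE).2
    rw [rk_bot] at this
    omega
  -- The flats left out are `⊥` and the atoms, whose classes vanish in the Chow ring.
  · have h : rk E < 2 := by simpa using hE
    by_cases h0 : rk E = 0
    · rw [rk_eq_zero.mp h0, flatClass_bot]
    · exact flatClass_chowIdeal_of_isAtom (isAtom_iff_rk_eq_one.mpr (by omega))
  · rw [chowIdeal_eq_span] at hq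
    refine mul_truncationHom_eq_zero ?_ hq
    rintro r (hr | ⟨y, hy, rfl⟩)
    · exact mul_truncationHom_joinRelation hI hr
    · obtain ⟨a, ha, -, -, h⟩ := mul_truncationHom_atom hI hy
      rw [truncationHom_X, h, flatClass_chowIdeal_of_isAtom ha, mul_zero]
  · have hu := (isFlatMap_flatClass_chowIdeal (L := TrRestrict E)).comp_ofFlat
    have hcov : ∀ K, K ⩿ E → flatClass (chowIdeal (TrRestrict E)) (TrRestrict.ofFlat E K) =
        flatClass (chowIdeal (TrRestrict E)) (TrRestrict.ofFlat E E) :=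
      fun K hK => congrArg _ (TrRestrict.ofFlat_eq_of_wcovBy hK)
    have hE' : ¬IsAtom E := fun h => by
      have := (Finset.mem_filter.mp hE).2
      rw [isAtom_iff_rk_eq_one.mp h] at this
      omega
    rw [chowIdeal_eq_span] at hp
    refine addMonoidHom_eq_zero_of_mem_span _ _ ?_ hp
    rintro r (hr | ⟨a, ha, rfl⟩) m
    · exact divTop_mul_joinRelation hu _ (isJoinHomogeneous_monomial m 1) hr
    · refine divTop_mul_atom hu hcov m ha (fun haE => ?_) hE'
      rcases TrRestrict.ofFlat_eq_bot_or_isAtom ha haE with h | h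
      · simp only [h, flatClass_bot]
      · exact flatClass_chowIdeal_of_isAtom h

end Main

end MatroidChow

theorem mainTheorem4 (L : Type*) [Lattice L] [BoundedOrder L] [Fintype L] [DecidableEq L]
    [MatroidChow.IsMatroidLattice L] :
    MatroidChow.augHilbertSeries L =
        1 + ∑ F : L with F ≠ ⊥,
          PowerSeries.X * MatroidChow.augHilbertSeries (MatroidChow.TrRestrict F) ∧
      MatroidChow.hilbertSeries L =
        1 + ∑ F : L with 2 ≤ MatroidChow.rk F,
          PowerSeries.X * MatroidChow.hilbertSeries (MatroidChow.TrRestrict F) := by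
  constructor
  · ext (_ | k)
    · simp [MatroidChow.augHilbertSeries, MatroidChow.finrank_augChowPiece_zero]
    · simp [MatroidChow.augHilbertSeries, MatroidChow.finrank_augChowPiece_succ,
        PowerSeries.coeff_succ_X_mul, PowerSeries.coeff_one]
  · ext (_ | k)
    · simp [MatroidChow.hilbertSeries, MatroidChow.finrank_chowPiece_zero]
    · simp [MatroidChow.hilbertSeries, MatroidChow.finrank_chowPiece_succ,
        PowerSeries.coeff_succ_X_mul, PowerSeries.coeff_one]
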